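/- Let $\mathfrak g$ be a real Lie algebra of dimension $4$ that is solvable and of type I, i.e. for every $X\in\mathfrak g$ all the (complex) eigenvalues of $\operatorname{ad}_X$ are imaginary (possibly zero). Then either $\mathfrak g$ is abelian, i.e. isomorphic to $\mathbb R^4$, or $\mathfrak g$ is isomorphic to one of the following Lie algebras: $\mathfrak r'_{3,0}\times\mathbb R$, $\mathfrak h_3\times\mathbb R$, $\mathfrak d'_{4,0}$ or $\mathfrak n_4$. Here the real Lie algebras $\mathfrak h_3,\mathfrak r'_{3,0}$ (of dimension $3$) and $\mathfrak n_4,\mathfrak d'_{4,0}$ (of dimension $4$) are given, in a basis $e_1,e_2,\dots$, by the following brackets, all other brackets $[e_i,e_j]$ with $i<j$ being zero: $$\mathfrak h_3:\ [e_1,e_2]=e_3;\qquad \mathfrak r'_{3,0}:\ [e_1,e_2]=-e_3,\ [e_1,e_3]=e_2;$$ $$\mathfrak n_4:\ [e_1,e_4]=-e_2,\ [e_2,e_4]=-e_3;\qquad \mathfrak d'_{4,0}:\ [e_1,e_2]=e_3,\ [e_1,e_4]=e_2,\ [e_2,e_4]=-e_1.$$ -/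

import Mathlib

namespace LieTypeI

open scoped TensorProduct

/-- A real Lie algebra `L` is of type I if for every `X` all the (complex) eigenvalues of the
operator `ad X` are imaginary, possibly zero. The complex eigenvalues of the real operator are
those of its complexification, acting on `ℂ ⊗ L`. -/
def IsTypeI (L : Type*) [LieRing L] [LieAlgebra ℝ L] : Prop :=
  ∀ (X : L) (μ : ℂ),
    Module.End.HasEigenvalue ((LieAlgebra.ad ℝ L X : L →ₗ[ℝ] L).baseChange ℂ) μ → μ.re = 0

/-- The Lie algebra `𝔥₃`: the space `ℝ³` with standard basis `e₁, e₂, e₃` and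
`[e₁, e₂] = e₃`; the brackets `[eᵢ, eⱼ]` with `i < j` that are not listed vanish. -/
def H3 : Type := Fin 3 → ℝ

noncomputable instance : AddCommGroup H3 := inferInstanceAs (AddCommGroup (Fin 3 → ℝ))

noncomputable instance : Module ℝ H3 := inferInstanceAs (Module ℝ (Fin 3 → ℝ))

/-- The bracket of `𝔥₃` in coordinates. -/
def H3.lie (x y : Fin 3 → ℝ) : Fin 3 → ℝ :=
  ![0, 0, x 0 * y 1 - x 1 * y 0]

noncomputable instance : LieRing H3 where
  bracket x y := H3.lie x y
  add_lie := by
    have h : ∀ (x y z : Fin 3 → ℝ),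
        H3.lie (x + y) z = H3.lie x z + H3.lie y z := by
      intros; ext i; fin_cases i <;> simp [H3.lie]; ring
    exact h
  lie_add := by
    have h : ∀ (x y z : Fin 3 → ℝ),
        H3.lie x (y + z) = H3.lie x y + H3.lie x z := by
      intros; ext i; fin_cases i <;> simp [H3.lie]; ring
    exact h
  lie_self := by
    have h : ∀ (x : Fin 3 → ℝ),
        H3.lie x x = 0 := by
      intros; ext i; fin_cases i <;> simp [H3.lie]; ring
    exact h
  leibniz_lie := by
    have h : ∀ (x y z : Fin 3 → ℝ),
        H3.lie x (H3.lie y z) = H3.lie (H3.lie x y) z + H3.lie y (H3.lie x z) := by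
      intros; ext i; fin_cases i <;> simp [H3.lie]
    exact h

noncomputable instance : LieAlgebra ℝ H3 where
  lie_smul := by
    have h : ∀ (t : ℝ) (x y : Fin 3 → ℝ),
        H3.lie x (t • y) = t • H3.lie x y := by
      intros; ext i; fin_cases i <;> simp [H3.lie]; ring
    exact h

/-- The Lie algebra `𝔯'_{3,0}`: the space `ℝ³` with standard basis `e₁, e₂, e₃` and
`[e₁, e₂] = -e₃, [e₁, e₃] = e₂`; the brackets `[eᵢ, eⱼ]` with `i < j` that are not listed vanish. -/
def R30 : Type := Fin 3 → ℝ

noncomputable instance : AddCommGroup R30 := inferInstanceAs (AddCommGroup (Fin 3 → ℝ))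

noncomputable instance : Module ℝ R30 := inferInstanceAs (Module ℝ (Fin 3 → ℝ))

/-- The bracket of `𝔯'_{3,0}` in coordinates. -/
def R30.lie (x y : Fin 3 → ℝ) : Fin 3 → ℝ :=
  ![0, x 0 * y 2 - x 2 * y 0, -(x 0 * y 1 - x 1 * y 0)]

noncomputable instance : LieRing R30 where
  bracket x y := R30.lie x y
  add_lie := by
    have h : ∀ (x y z : Fin 3 → ℝ),
        R30.lie (x + y) z = R30.lie x z + R30.lie y z := by
      intros; ext i; fin_cases i <;> simp [R30.lie] <;> ring
    exact h
  lie_add := by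
    have h : ∀ (x y z : Fin 3 → ℝ),
        R30.lie x (y + z) = R30.lie x y + R30.lie x z := by
      intros; ext i; fin_cases i <;> simp [R30.lie] <;> ring
    exact h
  lie_self := by
    have h : ∀ (x : Fin 3 → ℝ),
        R30.lie x x = 0 := by
      intros; ext i; fin_cases i <;> simp [R30.lie] <;> ring
    exact h
  leibniz_lie := by
    have h : ∀ (x y z : Fin 3 → ℝ),
        R30.lie x (R30.lie y z) = R30.lie (R30.lie x y) z + R30.lie y (R30.lie x z) := by
      intros; ext i; fin_cases i <;> simp [R30.lie] <;> ring
    exact h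

noncomputable instance : LieAlgebra ℝ R30 where
  lie_smul := by
    have h : ∀ (t : ℝ) (x y : Fin 3 → ℝ),
        R30.lie x (t • y) = t • R30.lie x y := by
      intros; ext i; fin_cases i <;> simp [R30.lie] <;> ring
    exact h

/-- The Lie algebra `𝔫₄`: the space `ℝ⁴` with standard basis `e₁, …, e₄` and
`[e₁, e₄] = -e₂, [e₂, e₄] = -e₃`; the brackets `[eᵢ, eⱼ]` with `i < j` that are not listed vanish. -/
def N4 : Type := Fin 4 → ℝ

noncomputable instance : AddCommGroup N4 := inferInstanceAs (AddCommGroup (Fin 4 → ℝ))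

noncomputable instance : Module ℝ N4 := inferInstanceAs (Module ℝ (Fin 4 → ℝ))

/-- The bracket of `𝔫₄` in coordinates. -/
def N4.lie (x y : Fin 4 → ℝ) : Fin 4 → ℝ :=
  ![0, -(x 0 * y 3 - x 3 * y 0), -(x 1 * y 3 - x 3 * y 1), 0]

noncomputable instance : LieRing N4 where
  bracket x y := N4.lie x y
  add_lie := by
    have h : ∀ (x y z : Fin 4 → ℝ),
        N4.lie (x + y) z = N4.lie x z + N4.lie y z := by
      intros; ext i; fin_cases i <;> simp [N4.lie] <;> ring
    exact h
  lie_add := by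
    have h : ∀ (x y z : Fin 4 → ℝ),
        N4.lie x (y + z) = N4.lie x y + N4.lie x z := by
      intros; ext i; fin_cases i <;> simp [N4.lie] <;> ring
    exact h
  lie_self := by
    have h : ∀ (x : Fin 4 → ℝ),
        N4.lie x x = 0 := by
      intros; ext i; fin_cases i <;> simp [N4.lie] <;> ring
    exact h
  leibniz_lie := by
    have h : ∀ (x y z : Fin 4 → ℝ),
        N4.lie x (N4.lie y z) = N4.lie (N4.lie x y) z + N4.lie y (N4.lie x z) := by
      intros; ext i; fin_cases i <;> simp [N4.lie]; ring
    exact h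

noncomputable instance : LieAlgebra ℝ N4 where
  lie_smul := by
    have h : ∀ (t : ℝ) (x y : Fin 4 → ℝ),
        N4.lie x (t • y) = t • N4.lie x y := by
      intros; ext i; fin_cases i <;> simp [N4.lie] <;> ring
    exact h

/-- The Lie algebra `𝔡'_{4,0}`: the space `ℝ⁴` with standard basis `e₁, …, e₄` and
`[e₁, e₂] = e₃, [e₁, e₄] = e₂, [e₂, e₄] = -e₁`; the brackets `[eᵢ, eⱼ]` with `i < j` that are not listed vanish. -/
def D40 : Type := Fin 4 → ℝ

noncomputable instance : AddCommGroup D40 := inferInstanceAs (AddCommGroup (Fin 4 → ℝ))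

noncomputable instance : Module ℝ D40 := inferInstanceAs (Module ℝ (Fin 4 → ℝ))

/-- The bracket of `𝔡'_{4,0}` in coordinates. -/
def D40.lie (x y : Fin 4 → ℝ) : Fin 4 → ℝ :=
  ![-(x 1 * y 3 - x 3 * y 1), x 0 * y 3 - x 3 * y 0, x 0 * y 1 - x 1 * y 0, 0]

noncomputable instance : LieRing D40 where
  bracket x y := D40.lie x y
  add_lie := by
    have h : ∀ (x y z : Fin 4 → ℝ),
        D40.lie (x + y) z = D40.lie x z + D40.lie y z := by
      intros; ext i; fin_cases i <;> simp [D40.lie] <;> ring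
    exact h
  lie_add := by
    have h : ∀ (x y z : Fin 4 → ℝ),
        D40.lie x (y + z) = D40.lie x y + D40.lie x z := by
      intros; ext i; fin_cases i <;> simp [D40.lie] <;> ring
    exact h
  lie_self := by
    have h : ∀ (x : Fin 4 → ℝ),
        D40.lie x x = 0 := by
      intros; ext i; fin_cases i <;> simp [D40.lie] <;> ring
    exact h
  leibniz_lie := by
    have h : ∀ (x y z : Fin 4 → ℝ),
        D40.lie x (D40.lie y z) = D40.lie (D40.lie x y) z + D40.lie y (D40.lie x z) := by
      intros; ext i; fin_cases i <;> simp [D40.lie] <;> ring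
    exact h

noncomputable instance : LieAlgebra ℝ D40 where
  lie_smul := by
    have h : ∀ (t : ℝ) (x y : Fin 4 → ℝ),
        D40.lie x (t • y) = t • D40.lie x y := by
      intros; ext i; fin_cases i <;> simp [D40.lie] <;> ring
    exact h

end LieTypeI

/- The line `ℝ` is regarded as a Lie algebra with its commutator bracket, which vanishes. -/
attribute [local instance] LieRing.ofAssociativeRing

namespace LieTypeI

open scoped TensorProduct

/-! Solvability puts `[L, L]` inside a hyperplane `K`, which is then an ideal, and type I passes to
`K`. So `L` is built up one dimension at a time, each step adjoining one vector that acts on the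
previous ideal. In dimension 2 the action is by a scalar, which must vanish; in dimension 3 it is
zero, nilpotent or a rotation of an abelian plane, so `K` is `ℝ³`, Heisenberg or the Euclidean
algebra.

In dimension 4 let `f` act on `K`. In each case type I turns real eigenvalues into zeros. If `K` is
abelian, the cubic characteristic polynomial gives a real eigenvector `k`, hence a kernel vector,
and modulo `k` the action on the remaining plane is again zero, nilpotent or a rotation. If `K` is
Heisenberg, its centre is killed and the plane modulo the centre is treated in the same way; inner
derivations remove the central components. If `K` is Euclidean, each of its derivations is inner up
to a dilation of the plane, and the dilation vanishes, so `L` is a direct product. The operator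
lemma behind all of this is `ImagEigenvalues.exists_normal_form`. -/

/-- The linear combination of four vectors with the given coefficients. -/
def comb {V : Type*} [AddCommGroup V] [Module ℝ V] (x y z w : V) : (Fin 4 → ℝ) →ₗ[ℝ] V where
  toFun c := c 0 • x + c 1 • y + c 2 • z + c 3 • w
  map_add' c d := by simp only [Pi.add_apply]; module
  map_smul' t c := by simp only [Pi.smul_apply, smul_eq_mul, RingHom.id_apply]; module

/-- Four vectors are linearly independent. -/
def Indep4 {V : Type*} [AddCommGroup V] [Module ℝ V] (x y z w : V) : Prop :=
  ∀ a b c d : ℝ, a • x + b • y + c • z + d • w = 0 → a = 0 ∧ b = 0 ∧ c = 0 ∧ d = 0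

theorem Indep4.comb_injective {V : Type*} [AddCommGroup V] [Module ℝ V] {x y z w : V}
    (h : Indep4 x y z w) : Function.Injective (comb x y z w) := by
  refine (injective_iff_map_eq_zero _).2 fun c hc => ?_
  obtain ⟨h0, h1, h2, h3⟩ := h _ _ _ _ hc
  funext i
  fin_cases i <;> assumption

/-! ### Recognising the listed algebras from structure constants -/

section Iso

variable {L : Type*} [LieRing L] [LieAlgebra ℝ L]

theorem lie_comb_comb (x y z w : L) (c d : Fin 4 → ℝ) :
    ⁅comb x y z w c, comb x y z w d⁆ =
      (c 0 * d 1 - c 1 * d 0) • ⁅x, y⁆ + (c 0 * d 2 - c 2 * d 0) • ⁅x, z⁆ +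
      (c 0 * d 3 - c 3 * d 0) • ⁅x, w⁆ + (c 1 * d 2 - c 2 * d 1) • ⁅y, z⁆ +
      (c 1 * d 3 - c 3 * d 1) • ⁅y, w⁆ + (c 2 * d 3 - c 3 * d 2) • ⁅z, w⁆ := by
  simp only [comb, LinearMap.coe_mk, AddHom.coe_mk, lie_add, add_lie, lie_smul, smul_lie, lie_self]
  rw [← lie_skew x y, ← lie_skew x z, ← lie_skew x w, ← lie_skew y z, ← lie_skew y w,
    ← lie_skew z w]
  module

/-- A Lie algebra of dimension four is isomorphic to any Lie algebra which in coordinates has the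
same brackets. -/
theorem nonempty_lieEquiv_of_comb {M : Type*} [LieRing M] [LieAlgebra ℝ M]
    (hdim : Module.finrank ℝ L = 4) {x y z w : L} (h : Indep4 x y z w)
    (φ : M ≃ₗ[ℝ] (Fin 4 → ℝ))
    (hφ : ∀ m n : M, comb x y z w (φ ⁅m, n⁆) = ⁅comb x y z w (φ m), comb x y z w (φ n)⁆) :
    Nonempty (L ≃ₗ⁅ℝ⁆ M) := by
  have : FiniteDimensional ℝ L := Module.finite_of_finrank_pos (by omega)
  let e : M ≃ₗ[ℝ] L := φ.trans
    (LinearEquiv.ofInjectiveOfFinrankEq (comb x y z w) h.comb_injective (by simp [hdim]))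
  have he : ∀ m, e m = comb x y z w (φ m) := fun m => rfl
  exact ⟨LieEquiv.symm { e with
    map_lie' := by
      intro m n
      change e ⁅m, n⁆ = ⁅e m, e n⁆
      simpa only [he] using hφ m n }⟩

theorem nonempty_lieEquiv_N4 (hdim : Module.finrank ℝ L = 4) {x y z w : L} (h : Indep4 x y z w)
    (hxy : ⁅x, y⁆ = 0) (hxz : ⁅x, z⁆ = 0) (hxw : ⁅x, w⁆ = -y)
    (hyz : ⁅y, z⁆ = 0) (hyw : ⁅y, w⁆ = -z) (hzw : ⁅z, w⁆ = 0) :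
    Nonempty (L ≃ₗ⁅ℝ⁆ N4) := by
  refine nonempty_lieEquiv_of_comb (M := N4) hdim h (LinearEquiv.refl ℝ (Fin 4 → ℝ)) ?_
  intro m n
  rw [lie_comb_comb, hxy, hxz, hxw, hyz, hyw, hzw]
  change comb x y z w (N4.lie m n) = (m 0 * n 1 - m 1 * n 0) • _ + (m 0 * n 2 - m 2 * n 0) • _ +
    (m 0 * n 3 - m 3 * n 0) • _ + (m 1 * n 2 - m 2 * n 1) • _ +
    (m 1 * n 3 - m 3 * n 1) • _ + (m 2 * n 3 - m 3 * n 2) • _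
  simp [comb, N4.lie]
  module

theorem nonempty_lieEquiv_D40 (hdim : Module.finrank ℝ L = 4) {x y z w : L} (h : Indep4 x y z w)
    (hxy : ⁅x, y⁆ = z) (hxz : ⁅x, z⁆ = 0) (hxw : ⁅x, w⁆ = y)
    (hyz : ⁅y, z⁆ = 0) (hyw : ⁅y, w⁆ = -x) (hzw : ⁅z, w⁆ = 0) :
    Nonempty (L ≃ₗ⁅ℝ⁆ D40) := by
  refine nonempty_lieEquiv_of_comb (M := D40) hdim h (LinearEquiv.refl ℝ (Fin 4 → ℝ)) ?_
  intro m n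
  rw [lie_comb_comb, hxy, hxz, hxw, hyz, hyw, hzw]
  change comb x y z w (D40.lie m n) = (m 0 * n 1 - m 1 * n 0) • _ + (m 0 * n 2 - m 2 * n 0) • _ +
    (m 0 * n 3 - m 3 * n 0) • _ + (m 1 * n 2 - m 2 * n 1) • _ +
    (m 1 * n 3 - m 3 * n 1) • _ + (m 2 * n 3 - m 3 * n 2) • _
  simp [comb, D40.lie]
  module

/-- Coordinates on `ℝ³ × ℝ`. -/
def coordProd : ((Fin 3 → ℝ) × ℝ) ≃ₗ[ℝ] (Fin 4 → ℝ) where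
  toFun p := ![p.1 0, p.1 1, p.1 2, p.2]
  invFun c := (![c 0, c 1, c 2], c 3)
  map_add' p q := by ext i; fin_cases i <;> simp
  map_smul' t p := by ext i; fin_cases i <;> simp
  left_inv p := by
    ext i
    · fin_cases i <;> simp
    · simp
  right_inv c := by ext i; fin_cases i <;> simp

theorem nonempty_lieEquiv_H3_prod (hdim : Module.finrank ℝ L = 4) {x y z w : L}
    (h : Indep4 x y z w)
    (hxy : ⁅x, y⁆ = z) (hxz : ⁅x, z⁆ = 0) (hxw : ⁅x, w⁆ = 0)
    (hyz : ⁅y, z⁆ = 0) (hyw : ⁅y, w⁆ = 0) (hzw : ⁅z, w⁆ = 0) :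
    Nonempty (L ≃ₗ⁅ℝ⁆ H3 × ℝ) := by
  refine nonempty_lieEquiv_of_comb (M := H3 × ℝ) hdim h coordProd ?_
  rintro ⟨m, s⟩ ⟨n, t⟩
  rw [lie_comb_comb, hxy, hxz, hxw, hyz, hyw, hzw]
  change comb x y z w (coordProd (H3.lie m n, s * t - t * s)) =
    (m 0 * n 1 - m 1 * n 0) • _ + (m 0 * n 2 - m 2 * n 0) • _ +
    (m 0 * t - s * n 0) • _ + (m 1 * n 2 - m 2 * n 1) • _ +
    (m 1 * t - s * n 1) • _ + (m 2 * t - s * n 2) • _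
  simp [comb, coordProd, H3.lie, mul_comm]

theorem nonempty_lieEquiv_R30_prod (hdim : Module.finrank ℝ L = 4) {x y z w : L}
    (h : Indep4 x y z w)
    (hxy : ⁅x, y⁆ = -z) (hxz : ⁅x, z⁆ = y) (hxw : ⁅x, w⁆ = 0)
    (hyz : ⁅y, z⁆ = 0) (hyw : ⁅y, w⁆ = 0) (hzw : ⁅z, w⁆ = 0) :
    Nonempty (L ≃ₗ⁅ℝ⁆ R30 × ℝ) := by
  refine nonempty_lieEquiv_of_comb (M := R30 × ℝ) hdim h coordProd ?_
  rintro ⟨m, s⟩ ⟨n, t⟩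
  rw [lie_comb_comb, hxy, hxz, hxw, hyz, hyw, hzw]
  change comb x y z w (coordProd (R30.lie m n, s * t - t * s)) =
    (m 0 * n 1 - m 1 * n 0) • _ + (m 0 * n 2 - m 2 * n 0) • _ +
    (m 0 * t - s * n 0) • _ + (m 1 * n 2 - m 2 * n 1) • _ +
    (m 1 * t - s * n 1) • _ + (m 2 * t - s * n 2) • _
  simp [comb, coordProd, R30.lie, mul_comm]
  module

end Iso

/-! ### The type I condition in real terms -/

/-- The complex eigenvalues of a real operator are imaginary, in terms of real and imaginary parts
of eigenvectors. -/
def ImagEigenvalues {V : Type*} [AddCommGroup V] [Module ℝ V] (T : V →ₗ[ℝ] V) : Prop :=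
  ∀ (u w : V) (a b : ℝ), T u = a • u - b • w → T w = b • u + a • w → a ≠ 0 → u = 0 ∧ w = 0

theorem imagEigenvalues_of_baseChange {V : Type*} [AddCommGroup V] [Module ℝ V] (T : V →ₗ[ℝ] V)
    (h : ∀ μ : ℂ, Module.End.HasEigenvalue (T.baseChange ℂ) μ → μ.re = 0) :
    ImagEigenvalues T := by
  intro u w a b hu hw ha
  set v : ℂ ⊗[ℝ] V := 1 ⊗ₜ[ℝ] u + Complex.I ⊗ₜ[ℝ] w with hv
  have hTv : T.baseChange ℂ v = (⟨a, b⟩ : ℂ) • v := by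
    have hab : (⟨a, b⟩ : ℂ) = a • (1 : ℂ) + b • Complex.I := by
      apply Complex.ext <;> simp
    have hI : (⟨a, b⟩ : ℂ) * Complex.I = a • Complex.I - b • (1 : ℂ) := by
      apply Complex.ext <;> simp
    simp only [hv, map_add, LinearMap.baseChange_tmul, hu, hw, smul_add, TensorProduct.smul_tmul',
      smul_eq_mul, mul_one, hI]
    simp only [hab, TensorProduct.add_tmul, TensorProduct.sub_tmul, TensorProduct.tmul_add,
      TensorProduct.tmul_sub, TensorProduct.smul_tmul]
    abel
  have hv0 : v = 0 := by
    by_contra hne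
    exact ha (h ⟨a, b⟩
      (Module.End.hasEigenvalue_of_hasEigenvector
        ⟨Module.End.mem_eigenspace_iff.2 hTv, hne⟩))
  -- Real functionals on `ℂ` descend to `ℂ ⊗ V → V`; the real and imaginary parts recover `u` and
  -- `w`.
  have key : ∀ f : ℂ →ₗ[ℝ] ℝ, f 1 • u + f Complex.I • w = 0 := fun f => by
    have := congrArg ((TensorProduct.lid ℝ V).toLinearMap ∘ₗ LinearMap.rTensor V f) hv0
    simpa [hv] using this
  exact ⟨by simpa using key Complex.reLm, by simpa using key Complex.imLm⟩

/-- The complex eigenvalues of all operators `ad X` are imaginary. -/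
def ImagAd (L : Type*) [LieRing L] [LieAlgebra ℝ L] : Prop :=
  ∀ X : L, ImagEigenvalues (LieAlgebra.ad ℝ L X : L →ₗ[ℝ] L)

theorem IsTypeI.imagAd {L : Type*} [LieRing L] [LieAlgebra ℝ L] (h : IsTypeI L) : ImagAd L :=
  fun X => imagEigenvalues_of_baseChange _ (h X)

/-- In real terms this is immediate: an eigenvector pair in `K` is one in `L`. -/
theorem ImagAd.lieSubalgebra {L : Type*} [LieRing L] [LieAlgebra ℝ L] (h : ImagAd L)
    (K : LieSubalgebra ℝ L) : ImagAd K := by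
  intro X u w a b hu hw ha
  have := h X u w a b (by simpa using congrArg K.subtype hu) (by simpa using congrArg K.subtype hw) ha
  simpa using this

/-- The kernel of a nonzero functional vanishing on the derived algebra contains every bracket, so
it is an ideal. -/
theorem exists_codim_one {L : Type*} [LieRing L] [LieAlgebra ℝ L] {n : ℕ}
    (hdim : Module.finrank ℝ L = n + 1) (hsolv : LieAlgebra.IsSolvable L) :
    ∃ (K : LieSubalgebra ℝ L) (e : L), Module.finrank ℝ K = n ∧ e ∉ K ∧
      (∀ x y : L, ⁅x, y⁆ ∈ K) ∧ ∀ x : L, ∃ (c : ℝ) (k : K), x = c • e + k := by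
  have : FiniteDimensional ℝ L := Module.finite_of_finrank_pos (by omega)
  have : Nontrivial L := Module.nontrivial_of_finrank_pos (R := ℝ) (by omega)
  have hlt : (LieAlgebra.derivedSeries ℝ L 1).toSubmodule < ⊤ := by
    have := LieAlgebra.derivedSeries_lt_top_of_solvable ℝ L
    simpa [lt_top_iff_ne_top] using this
  obtain ⟨f, hf0, hf⟩ := Submodule.exists_le_ker_of_lt_top _ hlt
  have hbr : ∀ x y : L, f ⁅x, y⁆ = 0 := by
    intro x y
    apply hf
    change ⁅x, y⁆ ∈ LieAlgebra.derivedSeries ℝ L 1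
    rw [LieAlgebra.derivedSeries_def, LieAlgebra.derivedSeriesOfIdeal_succ,
      LieAlgebra.derivedSeriesOfIdeal_zero]
    exact LieSubmodule.lie_mem_lie (LieSubmodule.mem_top x) (LieSubmodule.mem_top y)
  obtain ⟨e, he⟩ : ∃ e, f e = 1 := (LinearMap.surjective hf0) 1
  refine ⟨{ LinearMap.ker f with lie_mem' := fun {x y} _ _ => hbr x y }, e, ?_, ?_, hbr, ?_⟩
  · have := Module.Dual.finrank_ker_add_one_of_ne_zero hf0
    change Module.finrank ℝ (LinearMap.ker f) = n
    omega
  · change ¬ f e = 0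
    simp [he]
  · intro x
    refine ⟨f x, ⟨x - f x • e, ?_⟩, ?_⟩
    · change f (x - f x • e) = 0
      simp [he]
    · simp

/-! ### Operators with imaginary eigenvalues on a plane; real eigenvectors in dimension 3 -/

section Operators

variable {V : Type*} [AddCommGroup V] [Module ℝ V]

theorem ImagEigenvalues.eq_zero_of_eigenvector {T : V →ₗ[ℝ] V} (hT : ImagEigenvalues T) {y : V}
    {r : ℝ} (hy : T y = r • y) (h0 : y ≠ 0) : r = 0 := by
  by_contra hr
  exact h0 (hT y 0 r 0 (by simpa using hy) (by simp) hr).1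

theorem exists_real_eigenvector_of_discr_nonneg {a b c d : ℝ}
    (h : 0 ≤ (a + d) ^ 2 - 4 * (a * d - b * c)) (hne : ¬ (a + d = 0 ∧ 0 ≤ a * d - b * c)) :
    ∃ r α β : ℝ, r ≠ 0 ∧ (α ≠ 0 ∨ β ≠ 0) ∧ a * α + c * β = r * α ∧ b * α + d * β = r * β := by
  obtain ⟨r, hr, hroot⟩ : ∃ r : ℝ, r ≠ 0 ∧ r ^ 2 - (a + d) * r + (a * d - b * c) = 0 := by
    set q := Real.sqrt ((a + d) ^ 2 - 4 * (a * d - b * c)) with hq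
    have hq2 : q ^ 2 = (a + d) ^ 2 - 4 * (a * d - b * c) := Real.sq_sqrt h
    -- The roots are `(a + d ± q) / 2`; both vanish only when trace and determinant are zero, which
    -- `hne` excludes.
    by_cases h1 : a + d + q = 0
    · refine ⟨(a + d - q) / 2, fun h2 => hne ?_, by linear_combination hq2 / 4⟩
      have h3 : a + d = 0 := by linarith
      have h4 : q = 0 := by linarith
      refine ⟨h3, ?_⟩
      rw [h3, h4] at hq2
      linarith
    · exact ⟨(a + d + q) / 2, by positivity, by linear_combination hq2 / 4⟩
  -- The first row gives the eigenvector `(c, r - a)`, the second `(r - d, b)`; if both vanish the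
  -- matrix is scalar.
  by_cases h1 : c = 0 ∧ r = a
  · obtain ⟨rfl, rfl⟩ := h1
    by_cases h2 : r - d = 0 ∧ b = 0
    · exact ⟨r, 1, 0, hr, Or.inl one_ne_zero, by ring, by simp [h2.2]⟩
    · refine ⟨r, r - d, b, hr, by tauto, by ring, by ring⟩
  · refine ⟨r, c, r - a, hr, ?_, by ring, by linear_combination -hroot⟩
    by_contra! h2
    exact h1 ⟨h2.1, by linarith [h2.2]⟩

/-- If `T` has imaginary eigenvalues, so has the operator induced on a plane modulo a vector of the
kernel: its trace vanishes and its determinant is nonnegative. -/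
theorem ImagEigenvalues.trace_eq_zero_and_det_nonneg {T : V →ₗ[ℝ] V} (hT : ImagEigenvalues T)
    {u w k : V} {a b c d s t : ℝ} (hk : T k = 0)
    (hind : ∀ α β γ : ℝ, α • u + β • w + γ • k = 0 → α = 0 ∧ β = 0)
    (hu : T u = a • u + b • w + s • k) (hw : T w = c • u + d • w + t • k) :
    a + d = 0 ∧ 0 ≤ a * d - b * c := by
  by_contra hne
  rcases le_or_gt 0 ((a + d) ^ 2 - 4 * (a * d - b * c)) with h | h
  · obtain ⟨r, α, β, hr, hαβ, h1, h2⟩ := exists_real_eigenvector_of_discr_nonneg h hne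
    -- The `k`-coordinate lifts the eigenvector from the quotient by `k`; this is possible because
    -- `r ≠ 0`.
    refine hr (hT.eq_zero_of_eigenvector (y := α • u + β • w + ((α * s + β * t) / r) • k) ?_ ?_)
    · have h3 : r * ((α * s + β * t) / r) = α * s + β * t := by field_simp
      simp only [map_add, map_smul, hu, hw, hk, smul_add, smul_smul, h3, ← h1, ← h2]
      module
    · intro h0
      have := hind _ _ _ h0
      tauto
  · have hdet : a * d - b * c ≠ 0 := by nlinarith [sq_nonneg (a + d)]
    have htr : a + d ≠ 0 := fun h0 => hne ⟨h0, by nlinarith⟩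
    have hb : b ≠ 0 := by
      rintro rfl
      nlinarith [sq_nonneg (a - d)]
    set b0 := Real.sqrt ((a * d - b * c) - (a + d) ^ 2 / 4) with hb0
    have hb0' : b0 ^ 2 = (a * d - b * c) - (a + d) ^ 2 / 4 := Real.sq_sqrt (by linarith)
    have hb0ne : b0 ≠ 0 := by
      intro h0
      rw [h0] at hb0'
      linarith
    set g := (b * t - d * s) / (a * d - b * c) with hg
    have hg' : g * (a * d - b * c) = b * t - d * s := div_mul_cancel₀ _ hdet
    -- the vector `u + γ k` is annihilated by the characteristic polynomial of the plane
    have hTy : T (u + (-g) • k) = a • u + b • w + s • k := by simp [hu, hk]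
    have hTTy : T (a • u + b • w + s • k) =
        (a + d) • (a • u + b • w + s • k) - (a * d - b * c) • (u + (-g) • k) := by
      have h3 : (a * d - b * c) • ((-g) • k) = (d * s - b * t) • k := by
        rw [smul_smul]; congr 1; linear_combination -hg'
      rw [smul_add (a * d - b * c), h3]
      simp only [map_add, map_smul, hu, hw, hk]
      module
    set y := u + (-g) • k
    set y' := a • u + b • w + s • k
    -- With `p = (a + d) / 2`, `(T - p)² y = -b0² y`, so `(T - p) y` and `b0 y` form an eigenvector
    -- pair for `p + i b0`.
    have := hT (y' - ((a + d) / 2) • y) (b0 • y) ((a + d) / 2) b0 ?_ ?_ (by positivity)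
    · have h0 := this.2
      have h1 := hind b0 0 (b0 * -g) (by rw [← h0]; simp only [y]; module)
      exact hb0ne h1.1
    · have h4 : b0 • (b0 • y) = ((a * d - b * c) - (a + d) ^ 2 / 4) • y := by
        rw [smul_smul, ← hb0']; ring_nf
      rw [h4, map_sub, map_smul, hTy, hTTy]
      module
    · rw [map_smul, hTy]
      module

/-- Normal forms of an operator with imaginary eigenvalues on a plane, modulo a vector of the
kernel. -/
theorem ImagEigenvalues.exists_normal_form {T : V →ₗ[ℝ] V} (hT : ImagEigenvalues T)
    {u w k : V} {a b c d s t : ℝ} (hk : T k = 0)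
    (hind : ∀ α β γ : ℝ, α • u + β • w + γ • k = 0 → α = 0 ∧ β = 0)
    (hu : T u = a • u + b • w + s • k) (hw : T w = c • u + d • w + t • k) :
    ∃ (α β γ δ s' t' : ℝ) (u' w' : V), α * δ - β * γ ≠ 0 ∧ u' = α • u + β • w ∧
      w' = γ • u + δ • w ∧
      ((T u' = s' • k ∧ T w' = t' • k) ∨ (T u' = w' + s' • k ∧ T w' = t' • k) ∨
        ∃ r : ℝ, r ≠ 0 ∧ T u' = r • w' + s' • k ∧ T w' = -r • u' + t' • k) := by
  obtain ⟨htr, hdet⟩ := hT.trace_eq_zero_and_det_nonneg hk hind hu hw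
  obtain rfl : d = -a := by linarith
  -- Modulo `k` the trace is zero, so by Cayley-Hamilton `T² = -det`: nilpotent if `det = 0`, and
  -- otherwise `T / √det` is a complex structure.
  rcases hdet.eq_or_lt with h | h
  · by_cases hb : b = 0
    · subst hb
      obtain rfl : a = 0 := by nlinarith
      by_cases hc : c = 0
      · subst hc
        exact ⟨1, 0, 0, 1, s, t, u, w, by norm_num, by module, by module,
          Or.inl ⟨by rw [hu]; module, by rw [hw]; module⟩⟩
      · exact ⟨0, 1, c, 0, t, c * s, w, c • u, by simpa using hc, by module, by module,
          Or.inr (Or.inl ⟨by rw [hw]; module, by rw [map_smul, hu]; module⟩)⟩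
    · refine ⟨1, 0, a, b, s, a * s + b * t, u, a • u + b • w, by simpa using hb, by module,
        by module, Or.inr (Or.inl ⟨hu, ?_⟩)⟩
      have h1 : b * c = - a * a := by linarith
      simp only [map_add, map_smul, hu, hw, smul_add, smul_smul, h1]
      module
  · set r := Real.sqrt (a * -a - b * c) with hr
    have hr0 : r ≠ 0 := (Real.sqrt_pos.2 h).ne'
    have hr2 : r * r = a * -a - b * c := Real.mul_self_sqrt h.le
    have hb : b ≠ 0 := by
      rintro rfl
      nlinarith [sq_nonneg a]
    refine ⟨1, 0, a / r, b / r, s, (a * s + b * t) / r, u, r⁻¹ • (a • u + b • w), ?_, by module,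
      ?_, Or.inr (Or.inr ⟨r, hr0, ?_, ?_⟩)⟩
    · simp [hb, hr0]
    · rw [div_eq_inv_mul, div_eq_inv_mul]; module
    · rw [smul_inv_smul₀ hr0, hu]
    · have h1 : -r = r⁻¹ * (a * a + b * c) := by
        field_simp
        linarith
      rw [h1, div_eq_inv_mul]
      simp only [map_add, map_smul, hu, hw]
      module

theorem exists_real_eigenvector_fin_three (M : Matrix (Fin 3) (Fin 3) ℝ) :
    ∃ (r : ℝ) (v : Fin 3 → ℝ), v ≠ 0 ∧ M.mulVec v = r • v := by
  obtain ⟨p, q, s, hdet⟩ : ∃ p q s : ℝ, ∀ x : ℝ,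
      (x • (1 : Matrix (Fin 3) (Fin 3) ℝ) - M).det = x ^ 3 + p * x ^ 2 + q * x + s := by
    refine ⟨-(M 0 0 + M 1 1 + M 2 2), M 0 0 * M 1 1 - M 0 1 * M 1 0 + M 0 0 * M 2 2 - M 0 2 * M 2 0
      + M 1 1 * M 2 2 - M 1 2 * M 2 1, -M.det, fun x => ?_⟩
    simp [Matrix.det_fin_three]
    ring
  obtain ⟨r, hr⟩ : ∃ r : ℝ, r ^ 3 + p * r ^ 2 + q * r + s = 0 := by
    -- At `±m` the cubic term dominates the others, so the polynomial changes sign on `[-m, m]`.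
    set m := 1 + |p| + |q| + |s| with hm
    have hp := abs_nonneg p
    have hq := abs_nonneg q
    have hs := abs_nonneg s
    have hm1 : 1 ≤ m := by linarith
    have e1 : |p| * m ^ 2 + |q| * m + |s| ≤ m ^ 3 := by
      have h1 : |q| * m ≤ |q| * m ^ 2 := by nlinarith [mul_nonneg hq (by linarith : 0 ≤ m)]
      have h2 : |s| ≤ |s| * m ^ 2 := le_mul_of_one_le_right hs (one_le_pow₀ hm1)
      have h3 : m ^ 3 = m ^ 2 + |p| * m ^ 2 + |q| * m ^ 2 + |s| * m ^ 2 := by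
        rw [pow_succ' m 2]; nth_rw 1 [hm]; ring
      nlinarith [sq_nonneg m]
    have hmp : 0 ≤ m ^ 2 := sq_nonneg m
    have a1 := mul_le_mul_of_nonneg_right (neg_abs_le p) hmp
    have a2 := mul_le_mul_of_nonneg_right (le_abs_self p) hmp
    have a3 := mul_le_mul_of_nonneg_right (neg_abs_le q) (by linarith : 0 ≤ m)
    have a4 := mul_le_mul_of_nonneg_right (le_abs_self q) (by linarith : 0 ≤ m)
    have a5 := neg_abs_le s
    have a6 := le_abs_self s
    have := intermediate_value_Icc (a := -m) (b := m) (by linarith)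
      (f := fun x : ℝ => x ^ 3 + p * x ^ 2 + q * x + s) (by fun_prop)
    obtain ⟨r, -, hr⟩ := this (show (0 : ℝ) ∈ _ by constructor <;> ring_nf <;> linarith)
    exact ⟨r, hr⟩
  obtain ⟨v, hv, hv0⟩ := Matrix.exists_mulVec_eq_zero_iff.2 ((hdet r).trans hr)
  refine ⟨r, v, hv, ?_⟩
  rw [Matrix.sub_mulVec, Matrix.smul_mulVec, Matrix.one_mulVec, sub_eq_zero] at hv0
  exact hv0.symm

end Operators

/-! ### Solvable type I algebras of dimension 2 and 3 -/

section Flag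

theorem ImagAd.eq_zero_of_lie_eq_smul {L : Type*} [LieRing L] [LieAlgebra ℝ L] (h : ImagAd L)
    {x y : L} {r : ℝ} (hy : ⁅x, y⁆ = r • y) (h0 : y ≠ 0) : r = 0 :=
  (h x).eq_zero_of_eigenvector hy h0

theorem lie_rev {L : Type*} [LieRing L] {x y z : L} (h : ⁅x, y⁆ = z) : ⁅y, x⁆ = -z := by
  rw [← h, lie_skew]

/-- A complementary vector acts on the one-dimensional ideal by a real eigenvalue, which is zero by
type I. -/
theorem exists_adapted_of_finrank_two {L : Type*} [LieRing L] [LieAlgebra ℝ L]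
    (hdim : Module.finrank ℝ L = 2) (hsolv : LieAlgebra.IsSolvable L) (h : ImagAd L) :
    ∃ x y : L, (∀ a b : ℝ, a • x + b • y = 0 → a = 0 ∧ b = 0) ∧
      (∀ v : L, ∃ a b : ℝ, v = a • x + b • y) ∧ ⁅x, y⁆ = 0 := by
  obtain ⟨K, e, hK, he, hbr, hspan⟩ := exists_codim_one (n := 1) hdim hsolv
  obtain ⟨v, hv0, hv⟩ := finrank_eq_one_iff'.1 hK
  have hv0' : (v : L) ≠ 0 := by simpa using hv0
  refine ⟨e, v, ?_, ?_, ?_⟩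
  · intro a b hab
    have ha : a = 0 := by
      by_contra ha
      apply he
      have : e = (-(a⁻¹ * b)) • (v : L) := by
        have h1 : e = a⁻¹ • (a • e + b • (v : L)) - (a⁻¹ * b) • (v : L) := by
          rw [smul_add, inv_smul_smul₀ ha]; module
        rw [h1, hab]; module
      rw [this]
      exact K.smul_mem _ v.2
    subst ha
    simpa [hv0'] using hab
  · intro x
    obtain ⟨c, k, rfl⟩ := hspan x
    obtain ⟨b, rfl⟩ := hv k
    exact ⟨c, b, by simp⟩
  · obtain ⟨b, hb⟩ := hv ⟨⁅e, (v : L)⁆, hbr _ _⟩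
    have hb' : ⁅e, (v : L)⁆ = b • (v : L) := by simpa using (congrArg K.subtype hb).symm
    rw [hb', h.eq_zero_of_lie_eq_smul hb' hv0', zero_smul]

/-- The plane ideal is abelian by the previous dimension; the alternatives are the normal forms of
the complementary vector on it. -/
theorem exists_adapted_of_finrank_three {L : Type*} [LieRing L] [LieAlgebra ℝ L]
    (hdim : Module.finrank ℝ L = 3) (hsolv : LieAlgebra.IsSolvable L) (h : ImagAd L) :
    ∃ x y z : L, (∀ a b c : ℝ, a • x + b • y + c • z = 0 → a = 0 ∧ b = 0 ∧ c = 0) ∧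
      (∀ v : L, ∃ a b c : ℝ, v = a • x + b • y + c • z) ∧ ⁅y, z⁆ = 0 ∧
      ((⁅x, y⁆ = 0 ∧ ⁅x, z⁆ = 0) ∨ (⁅x, y⁆ = z ∧ ⁅x, z⁆ = 0) ∨ (⁅x, y⁆ = z ∧ ⁅x, z⁆ = -y)) := by
  obtain ⟨K, e, hK, he, hbr, hspan⟩ := exists_codim_one (n := 2) hdim hsolv
  obtain ⟨u, w, hind, hsp, huw⟩ := exists_adapted_of_finrank_two hK
      (Function.Injective.lieAlgebra_isSolvable (f := K.incl) Subtype.val_injective) (h.lieSubalgebra K)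
  have hind' : ∀ a b : ℝ, a • (u : L) + b • (w : L) = 0 → a = 0 ∧ b = 0 := fun a b hab =>
    hind a b (by exact_mod_cast hab)
  have hsp' : ∀ v ∈ K, ∃ a b : ℝ, v = a • (u : L) + b • (w : L) := fun v hv => by
    obtain ⟨a, b, hab⟩ := hsp ⟨v, hv⟩
    exact ⟨a, b, by simpa using congrArg K.subtype hab⟩
  have huw' : ⁅(u : L), (w : L)⁆ = 0 := by simpa using congrArg K.subtype huw
  have hmem : ∀ {a b c : ℝ}, a • e + b • (u : L) + c • (w : L) = 0 → a = 0 := by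
    intro a b c habc
    by_contra ha
    apply he
    have : e = (-(a⁻¹ * b)) • (u : L) + (-(a⁻¹ * c)) • (w : L) := by
      have h1 : e = a⁻¹ • (a • e + b • (u : L) + c • (w : L)) - (a⁻¹ * b) • (u : L)
          - (a⁻¹ * c) • (w : L) := by
        rw [smul_add, smul_add, inv_smul_smul₀ ha]; module
      rw [h1, habc]; module
    rw [this]
    exact K.add_mem (K.smul_mem _ u.2) (K.smul_mem _ w.2)
  obtain ⟨a, b, hab⟩ := hsp' _ (hbr e u)
  obtain ⟨c, d, hcd⟩ := hsp' _ (hbr e w)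
  -- With `k = 0` the normal form concerns the plane itself.
  obtain ⟨α, β, γ, δ, s, t, u', w', hdet, hu', hw', hcase⟩ :=
    (h e).exists_normal_form (u := (u : L)) (w := w) (k := 0) (a := a) (b := b) (c := c) (d := d)
      (s := 0) (t := 0) (by simp) (fun α β γ h0 => hind' α β (by simpa using h0))
      (by simpa using hab) (by simpa using hcd)
  simp only [LieAlgebra.ad_apply, smul_zero, add_zero] at hcase
  have hcomm : ⁅u', w'⁆ = 0 := by
    rw [hu', hw']
    simp [huw', lie_rev huw']
  -- The scaling of `e` normalises the speed of rotation to one.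
  have key : ∀ r : ℝ, r ≠ 0 →
      (∀ a b c : ℝ, a • (r • e) + b • u' + c • w' = 0 → a = 0 ∧ b = 0 ∧ c = 0) ∧
      (∀ v : L, ∃ a b c : ℝ, v = a • (r • e) + b • u' + c • w') := by
    intro r hr
    constructor
    · intro x y z hxyz
      have h1 : (x * r) • e + (y * α + z * γ) • (u : L) + (y * β + z * δ) • (w : L) = 0 := by
        rw [← hxyz, hu', hw']; module
      have h2 := hmem h1
      rw [h2, zero_smul, zero_add] at h1
      obtain ⟨h3, h4⟩ := hind' _ _ h1
      refine ⟨by simpa [hr] using h2, ?_, ?_⟩ <;> apply mul_left_cancel₀ hdet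
      · linear_combination δ * h3 - γ * h4
      · linear_combination α * h4 - β * h3
    · intro v
      obtain ⟨x, k, rfl⟩ := hspan v
      obtain ⟨y, z, hyz⟩ := hsp' k k.2
      obtain ⟨p, q, hp, hq⟩ : ∃ p q : ℝ, y = p * α + q * γ ∧ z = p * β + q * δ := by
        refine ⟨(y * δ - z * γ) / (α * δ - β * γ), (z * α - y * β) / (α * δ - β * γ), ?_, ?_⟩ <;>
        · rw [div_mul_eq_mul_div, div_mul_eq_mul_div, ← add_div, eq_div_iff hdet]; ring
      refine ⟨x / r, p, q, ?_⟩
      rw [hyz, hu', hw', smul_smul, div_mul_cancel₀ x hr, hp, hq]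
      module
  rcases hcase with ⟨h1, h2⟩ | ⟨h1, h2⟩ | ⟨r, hr, h1, h2⟩
  · have := key 1 one_ne_zero
    rw [one_smul] at this
    exact ⟨e, u', w', this.1, this.2, hcomm, Or.inl ⟨h1, h2⟩⟩
  · have := key 1 one_ne_zero
    rw [one_smul] at this
    exact ⟨e, u', w', this.1, this.2, hcomm, Or.inr (Or.inl ⟨h1, h2⟩)⟩
  · have := key r⁻¹ (inv_ne_zero hr)
    refine ⟨r⁻¹ • e, u', w', this.1, this.2, hcomm, Or.inr (Or.inr ⟨?_, ?_⟩)⟩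
    · rw [smul_lie, h1, inv_smul_smul₀ hr]
    · rw [smul_lie, h2, neg_smul, smul_neg, inv_smul_smul₀ hr]

/-- A basis of a four-dimensional solvable Lie algebra of type I adapted to an ideal of
codimension one in normal form. -/
theorem exists_adapted_of_finrank_four {L : Type*} [LieRing L] [LieAlgebra ℝ L]
    (hdim : Module.finrank ℝ L = 4) (hsolv : LieAlgebra.IsSolvable L) (h : ImagAd L) :
    ∃ f x y z : L, Indep4 f x y z ∧
      (∀ v v' : L, ∃ a b c : ℝ, ⁅v, v'⁆ = a • x + b • y + c • z) ∧ ⁅y, z⁆ = 0 ∧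
      ((⁅x, y⁆ = 0 ∧ ⁅x, z⁆ = 0) ∨ (⁅x, y⁆ = z ∧ ⁅x, z⁆ = 0) ∨ (⁅x, y⁆ = z ∧ ⁅x, z⁆ = -y)) := by
  obtain ⟨K, f, hK, hf, hbr, -⟩ := exists_codim_one (n := 3) hdim hsolv
  obtain ⟨x, y, z, hind, hsp, hyz, hcase⟩ :=
    exists_adapted_of_finrank_three hK
      (Function.Injective.lieAlgebra_isSolvable (f := K.incl) Subtype.val_injective) (h.lieSubalgebra K)
  refine ⟨f, x, y, z, ?_, ?_, by simpa using congrArg K.subtype hyz, ?_⟩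
  · intro a b c d habcd
    have ha : a = 0 := by
      by_contra ha
      apply hf
      have : f = (-(a⁻¹ * b)) • (x : L) + (-(a⁻¹ * c)) • (y : L) + (-(a⁻¹ * d)) • (z : L) := by
        have h1 : f = a⁻¹ • (a • f + b • (x : L) + c • (y : L) + d • (z : L)) - (a⁻¹ * b) • (x : L)
            - (a⁻¹ * c) • (y : L) - (a⁻¹ * d) • (z : L) := by
          rw [smul_add, smul_add, smul_add, inv_smul_smul₀ ha]; module
        rw [h1, habcd]; module
      rw [this]
      exact K.add_mem (K.add_mem (K.smul_mem _ x.2) (K.smul_mem _ y.2)) (K.smul_mem _ z.2)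
    subst ha
    exact ⟨rfl, hind b c d (by rw [zero_smul, zero_add] at habcd; exact_mod_cast habcd)⟩
  · intro v v'
    obtain ⟨a, b, c, habc⟩ := hsp ⟨⁅v, v'⁆, hbr v v'⟩
    exact ⟨a, b, c, by simpa using congrArg K.subtype habc⟩
  · simpa only [Subtype.ext_iff, LieSubalgebra.coe_bracket, ZeroMemClass.coe_zero,
      NegMemClass.coe_neg] using hcase

end Flag

/-! ### Extensions of the three possible ideals -/

section Classification

/-- The conclusion of the classification of four-dimensional solvable Lie algebras of type I. -/
def IsListed (L : Type*) [LieRing L] [LieAlgebra ℝ L] : Prop :=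
  IsLieAbelian L ∨ Nonempty (L ≃ₗ⁅ℝ⁆ R30 × ℝ) ∨ Nonempty (L ≃ₗ⁅ℝ⁆ H3 × ℝ) ∨
    Nonempty (L ≃ₗ⁅ℝ⁆ D40) ∨ Nonempty (L ≃ₗ⁅ℝ⁆ N4)

variable {L : Type*} [LieRing L] [LieAlgebra ℝ L]

theorem isLieAbelian_of_basis (hdim : Module.finrank ℝ L = 4) {x y z w : L} (h : Indep4 x y z w)
    (hxy : ⁅x, y⁆ = 0) (hxz : ⁅x, z⁆ = 0) (hxw : ⁅x, w⁆ = 0)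
    (hyz : ⁅y, z⁆ = 0) (hyw : ⁅y, w⁆ = 0) (hzw : ⁅z, w⁆ = 0) : IsLieAbelian L := by
  have : FiniteDimensional ℝ L := Module.finite_of_finrank_pos (by omega)
  have hsurj : Function.Surjective (comb x y z w) :=
    (LinearMap.injective_iff_surjective_of_finrank_eq_finrank (by simp [hdim])).1 h.comb_injective
  refine ⟨fun a b => ?_⟩
  obtain ⟨a, rfl⟩ := hsurj a
  obtain ⟨b, rfl⟩ := hsurj b
  rw [lie_comb_comb, hxy, hxz, hxw, hyz, hyw, hzw]
  simp

/-- Independence is preserved by triangular base changes in blocks: a base change of the first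
vector modulo the others, a base change of the second and third modulo the fourth, and a scaling of
the fourth. -/
theorem Indep4.change {f u w k : L} (h : Indep4 f u w k) {α β γ δ r p₁ p₂ p₃ q₁ q₂ m : ℝ}
    (hr : r ≠ 0) (hdet : α * δ - β * γ ≠ 0) (hm : m ≠ 0) {f' u' w' k' : L}
    (hf' : f' = r • f + p₁ • u + p₂ • w + p₃ • k) (hu' : u' = α • u + β • w + q₁ • k)
    (hw' : w' = γ • u + δ • w + q₂ • k) (hk' : k' = m • k) : Indep4 f' u' w' k' := by
  intro a b c d habcd
  have h1 : (a * r) • f + (a * p₁ + b * α + c * γ) • u + (a * p₂ + b * β + c * δ) • w +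
      (a * p₃ + b * q₁ + c * q₂ + d * m) • k = 0 := by
    rw [← habcd, hf', hu', hw', hk']; module
  obtain ⟨e1, e2, e3, e4⟩ := h _ _ _ _ h1
  have ha : a = 0 := by simpa [hr] using e1
  have hb : b = 0 := by
    apply mul_left_cancel₀ hdet
    rw [ha] at e2 e3
    linear_combination δ * e2 - γ * e3
  have hc : c = 0 := by
    apply mul_left_cancel₀ hdet
    rw [ha] at e2 e3
    linear_combination α * e3 - β * e2
  refine ⟨ha, hb, hc, ?_⟩
  rw [ha, hb, hc] at e4
  simpa [hm] using e4

theorem Indep4.rotate {x y z w : L} (h : Indep4 x y z w) : Indep4 y z w x := by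
  intro a b c d habcd
  have := h d a b c (by rw [← habcd]; abel)
  tauto

theorem Indep4.ne_zero {x y z w : L} (h : Indep4 x y z w) : w ≠ 0 := by
  rintro rfl
  simpa using h 0 0 0 1 (by simp)

theorem Indep4.right_three {x y z w : L} (h : Indep4 x y z w) (α β γ : ℝ)
    (h0 : α • y + β • z + γ • w = 0) : α = 0 ∧ β = 0 := by
  have := h 0 α β γ (by rw [zero_smul, zero_add, h0])
  tauto

/-- Semidirect products with an abelian ideal, given a common eigenvector. -/
theorem isListed_of_abelian_ideal_of_central (hdim : Module.finrank ℝ L = 4) (h : ImagAd L)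
    {f u w k : L} (hind : Indep4 f u w k) (huw : ⁅u, w⁆ = 0) (huk : ⁅u, k⁆ = 0) (hwk : ⁅w, k⁆ = 0)
    (hfk : ⁅f, k⁆ = 0) {a b c d s t : ℝ} (hu : ⁅f, u⁆ = a • u + b • w + s • k)
    (hw : ⁅f, w⁆ = c • u + d • w + t • k) : IsListed L := by
  obtain ⟨α, β, γ, δ, s, t, u', w', hdet, hu', hw', hcase⟩ :=
    (h f).exists_normal_form hfk hind.right_three hu hw
  simp only [LieAlgebra.ad_apply] at hcase
  have huw' : ⁅u', w'⁆ = 0 := by rw [hu', hw']; simp [huw, lie_rev huw]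
  have huk' : ⁅u', k⁆ = 0 := by rw [hu']; simp [huk, hwk]
  have hwk' : ⁅w', k⁆ = 0 := by rw [hw']; simp [huk, hwk]
  have hind' : Indep4 f u' w' k :=
    hind.change (r := 1) (p₁ := 0) (p₂ := 0) (p₃ := 0) (q₁ := 0) (q₂ := 0) (m := 1) one_ne_zero
      hdet one_ne_zero (by module) (by rw [hu']; module) (by rw [hw']; module) (by module)
  clear hu hw hu' hw' huw huk hwk hind
  -- If `f` maps the ideal into `ℝ k`, the result is abelian or `𝔥₃ × ℝ`. In the nilpotent case `t`
  -- decides between Jordan blocks of sizes 2 and 1 (`𝔥₃ × ℝ`) and one of size 3 (`𝔫₄`). For a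
  -- rotation, multiples of `k` absorb `s` and `t`.
  rcases hcase with ⟨h1, h2⟩ | ⟨h1, h2⟩ | ⟨r, hr, h1, h2⟩
  · by_cases hs : s = 0
    · by_cases ht : t = 0
      · subst hs ht
        exact Or.inl (isLieAbelian_of_basis hdim hind' (by simpa using h1) (by simpa using h2) hfk
          huw' huk' hwk')
      · have hi : Indep4 f w' (t • k) u' := fun a b c d h0 => by
          obtain ⟨e1, e2, e3, e4⟩ := hind' a d b (c * t) (by rw [← h0]; module)
          exact ⟨e1, e3, by simpa [ht] using e4, e2⟩
        subst hs
        exact Or.inr (Or.inr (Or.inl (nonempty_lieEquiv_H3_prod hdim hi h2 (by simp [hfk])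
          (by simpa using h1) (by simp [hwk']) (by simpa using lie_rev huw')
          (by simp [lie_rev huk']))))
    · have hi : Indep4 f u' (s • k) (w' - (t / s) • u') := fun a b c d h0 => by
        obtain ⟨e1, e2, e3, e4⟩ := hind' a (b - d * (t / s)) d (c * s) (by rw [← h0]; module)
        subst e3
        exact ⟨e1, by simpa using e2, by simpa [hs] using e4, rfl⟩
      refine Or.inr (Or.inr (Or.inl (nonempty_lieEquiv_H3_prod hdim hi h1 (by simp [hfk])
        ?_ (by simp [huk']) (by simp [huw']) (by simp [lie_rev huk', lie_rev hwk']))))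
      rw [lie_sub, lie_smul, h1, h2, smul_smul, div_mul_cancel₀ _ hs, sub_self]
  · by_cases ht : t = 0
    · have hi : Indep4 f u' (w' + s • k) k := fun a b c d h0 => by
        obtain ⟨e1, e2, e3, e4⟩ := hind' a b c (d + c * s) (by rw [← h0]; module)
        subst e3
        exact ⟨e1, e2, rfl, by simpa using e4⟩
      subst ht
      exact Or.inr (Or.inr (Or.inl (nonempty_lieEquiv_H3_prod hdim hi h1 (by simp [hfk, h2])
        hfk (by simp [huk', huw']) huk' (by simp [hwk']))))
    · have hi : Indep4 u' (w' + s • k) (t • k) f := fun a b c d h0 => by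
        obtain ⟨e1, e2, e3, e4⟩ := hind' d a b (b * s + c * t) (by rw [← h0]; module)
        subst e3
        exact ⟨e2, rfl, by simpa [ht] using e4, e1⟩
      exact Or.inr (Or.inr (Or.inr (Or.inr (nonempty_lieEquiv_N4 hdim hi (by simp [huw', huk'])
        (by simp [huk']) (lie_rev h1) (by simp [hwk']) (by simp [lie_rev h2, lie_rev hfk])
        (by simp [lie_rev hfk])))))
  · have hi : Indep4 ((-r⁻¹) • f) (u' - (t / r) • k) (w' + (s / r) • k) k :=
      hind'.change (r := -r⁻¹) (p₁ := 0) (p₂ := 0) (p₃ := 0) (α := 1) (β := 0) (γ := 0) (δ := 1)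
        (q₁ := -(t / r)) (q₂ := s / r) (m := 1) (by simpa using hr) (by norm_num) one_ne_zero
        (by module) (by module) (by module) (by module)
    refine Or.inr (Or.inl (nonempty_lieEquiv_R30_prod hdim hi ?_ ?_ (by simp [hfk])
      (by simp [huw', huk', lie_rev hwk']) (by simp [huk']) (by simp [hwk'])))
    · simp only [smul_lie, lie_sub, lie_smul, hfk, h1]
      match_scalars <;> field_simp
    · simp only [smul_lie, lie_add, lie_smul, hfk, h2]
      match_scalars <;> field_simp

/-- Semidirect products with an abelian ideal, given an eigenvector with a nonvanishing first
coordinate. -/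
theorem isListed_of_abelian_ideal_of_eigenvector (hdim : Module.finrank ℝ L = 4) (h : ImagAd L)
    {f x y z : L} (hind : Indep4 f x y z)
    (hbr : ∀ v v' : L, ∃ a b c : ℝ, ⁅v, v'⁆ = a • x + b • y + c • z)
    (hxy : ⁅x, y⁆ = 0) (hxz : ⁅x, z⁆ = 0) (hyz : ⁅y, z⁆ = 0) {r a b c : ℝ} (ha : a ≠ 0)
    (hk : ⁅f, a • x + b • y + c • z⁆ = r • (a • x + b • y + c • z)) : IsListed L := by
  have hi : Indep4 f y z (a • x + b • y + c • z) := fun t₀ t₁ t₂ t₃ h0 => by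
    obtain ⟨e1, e2, e3, e4⟩ :=
      hind t₀ (t₃ * a) (t₁ + t₃ * b) (t₂ + t₃ * c) (by rw [← h0]; module)
    obtain rfl : t₃ = 0 := by simpa [ha] using e2
    exact ⟨e1, by simpa using e3, by simpa using e4, rfl⟩
  have hr := h.eq_zero_of_lie_eq_smul hk hi.ne_zero
  rw [hr, zero_smul] at hk
  have key : ∀ v : L, ∃ p q s : ℝ, ⁅f, v⁆ = p • y + q • z + s • (a • x + b • y + c • z) := by
    intro v
    obtain ⟨α, β, γ, hv⟩ := hbr f v
    refine ⟨β - α / a * b, γ - α / a * c, α / a, ?_⟩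
    have : α = α / a * a := by field_simp
    rw [hv]
    nth_rw 1 [this]
    module
  obtain ⟨_, _, _, h1⟩ := key y
  obtain ⟨_, _, _, h2⟩ := key z
  exact isListed_of_abelian_ideal_of_central hdim h hi hyz
    (by simp [lie_rev hxy, hyz]) (by simp [lie_rev hxz, lie_rev hyz]) hk h1 h2

/-- An operator on a real three-dimensional space has a real eigenvector, and permuting the basis
makes its first coordinate nonzero. -/
theorem isListed_of_abelian_ideal (hdim : Module.finrank ℝ L = 4) (h : ImagAd L)
    {f x y z : L} (hind : Indep4 f x y z)
    (hbr : ∀ v v' : L, ∃ a b c : ℝ, ⁅v, v'⁆ = a • x + b • y + c • z)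
    (hxy : ⁅x, y⁆ = 0) (hxz : ⁅x, z⁆ = 0) (hyz : ⁅y, z⁆ = 0) : IsListed L := by
  obtain ⟨a₁, b₁, c₁, h1⟩ := hbr f x
  obtain ⟨a₂, b₂, c₂, h2⟩ := hbr f y
  obtain ⟨a₃, b₃, c₃, h3⟩ := hbr f z
  obtain ⟨r, v, hv, hrv⟩ :=
    exists_real_eigenvector_fin_three !![a₁, a₂, a₃; b₁, b₂, b₃; c₁, c₂, c₃]
  have e0 := congrFun hrv 0
  have e1 := congrFun hrv 1
  have e2 := congrFun hrv 2
  simp [Matrix.mulVec, dotProduct, Fin.sum_univ_three] at e0 e1 e2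
  have hk : ⁅f, v 0 • x + v 1 • y + v 2 • z⁆ = r • (v 0 • x + v 1 • y + v 2 • z) := by
    simp only [lie_add, lie_smul, h1, h2, h3, smul_add, smul_smul, ← e0, ← e1, ← e2]
    module
  obtain h0 | h0 | h0 : v 0 ≠ 0 ∨ v 1 ≠ 0 ∨ v 2 ≠ 0 := by
    by_contra! h0
    apply hv
    funext i
    fin_cases i
    exacts [h0.1, h0.2.1, h0.2.2]
  · exact isListed_of_abelian_ideal_of_eigenvector hdim h hind hbr hxy hxz hyz h0 hk
  · have e : v 0 • x + v 1 • y + v 2 • z = v 1 • y + v 0 • x + v 2 • z := by abel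
    rw [e] at hk
    refine isListed_of_abelian_ideal_of_eigenvector hdim h (x := y) (y := x) (z := z)
      (fun a b c d h0 => ?_) (fun v v' => ?_) (by simp [lie_rev hxy]) hyz hxz h0 hk
    · have := hind a c b d (by rw [← h0]; abel)
      tauto
    · obtain ⟨a, b, c, habc⟩ := hbr v v'
      exact ⟨b, a, c, by rw [habc]; abel⟩
  · have e : v 0 • x + v 1 • y + v 2 • z = v 2 • z + v 1 • y + v 0 • x := by abel
    rw [e] at hk
    refine isListed_of_abelian_ideal_of_eigenvector hdim h (x := z) (y := y) (z := x)
      (fun a b c d h0 => ?_) (fun v v' => ?_) (by simp [lie_rev hyz]) (by simp [lie_rev hxz])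
      (by simp [lie_rev hxy]) h0 hk
    · have := hind a d c b (by rw [← h0]; abel)
      tauto
    · obtain ⟨a, b, c, habc⟩ := hbr v v'
      exact ⟨c, b, a, by rw [habc]; abel⟩

/-- Semidirect products with a Heisenberg ideal. -/
theorem isListed_of_heisenberg_ideal (hdim : Module.finrank ℝ L = 4) (h : ImagAd L)
    {f x y z : L} (hind : Indep4 f x y z)
    (hbr : ∀ v v' : L, ∃ a b c : ℝ, ⁅v, v'⁆ = a • x + b • y + c • z)
    (hxy : ⁅x, y⁆ = z) (hxz : ⁅x, z⁆ = 0) (hyz : ⁅y, z⁆ = 0) : IsListed L := by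
  obtain ⟨a₁, b₁, c₁, h1⟩ := hbr f x
  obtain ⟨a₂, b₂, c₂, h2⟩ := hbr f y
  -- A derivation scales `z = ⁅x, y⁆` by its trace on the plane modulo `z`.
  have hfz : ⁅f, z⁆ = (a₁ + b₂) • z := by
    have := leibniz_lie f x y
    rw [h1, h2, hxy] at this
    rw [this]
    simp only [lie_add, add_lie, lie_smul, smul_lie, lie_self, hxy, hxz, lie_rev hyz]
    module
  rw [h.eq_zero_of_lie_eq_smul hfz hind.ne_zero, zero_smul] at hfz
  obtain ⟨α, β, γ, δ, s, t, u, w, hdet, hu, hw, hcase⟩ :=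
    (h f).exists_normal_form hfz hind.right_three h1 h2
  simp only [LieAlgebra.ad_apply] at hcase
  set κ := α * δ - β * γ with hκ
  have huw : ⁅u, w⁆ = κ • z := by
    rw [hu, hw]
    simp only [lie_add, add_lie, lie_smul, smul_lie, lie_self, hxy, lie_rev hxy]
    module
  have huz : ⁅u, z⁆ = 0 := by rw [hu]; simp [hxz, hyz]
  have hwz : ⁅w, z⁆ = 0 := by rw [hw]; simp [hxz, hyz]
  -- adding an element of the ideal makes the plane spanned by `u` and `w` invariant
  set g := f - (t / κ) • u + (s / κ) • w with hg
  have hgz : ⁅g, z⁆ = 0 := by simp [hg, hfz, huz, hwz]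
  have hgu : ⁅g, u⁆ = ⁅f, u⁆ - s • z := by
    simp only [hg, add_lie, sub_lie, smul_lie, lie_self, lie_rev huw]
    match_scalars <;> field_simp
  have hgw : ⁅g, w⁆ = ⁅f, w⁆ - t • z := by
    simp only [hg, add_lie, sub_lie, smul_lie, lie_self, huw]
    match_scalars <;> field_simp
  have hi : ∀ r : ℝ, r ≠ 0 → Indep4 (r • g) u w (κ • z) := fun r hr =>
    hind.change (r := r) (p₁ := r * (-(t / κ) * α + (s / κ) * γ))
      (p₂ := r * (-(t / κ) * β + (s / κ) * δ)) (p₃ := 0) (q₁ := 0) (q₂ := 0) hr hdet hdet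
      (by rw [hg, hu, hw]; module) (by rw [hu]; module) (by rw [hw]; module) rfl
  rcases hcase with ⟨h1, h2⟩ | ⟨h1, h2⟩ | ⟨r, hr, h1, h2⟩
  · rw [h1, sub_self] at hgu
    rw [h2, sub_self] at hgw
    exact Or.inr (Or.inr (Or.inl (nonempty_lieEquiv_H3_prod hdim (hi 1 one_ne_zero).rotate huw
      (by simp [huz]) (by simp [lie_rev hgu]) (by simp [hwz]) (by simp [lie_rev hgw])
      (by simp [lie_rev hgz]))))
  · rw [h1, add_sub_cancel_right] at hgu
    rw [h2, sub_self] at hgw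
    -- Here `g`, `w`, `z` span an abelian ideal, and `u` plays the role of `e₄`.
    refine Or.inr (Or.inr (Or.inr (Or.inr (nonempty_lieEquiv_N4 hdim (x := (-1 : ℝ) • g) (y := w)
      (z := κ • z) (w := u) (fun a b c d h0 => ?_) (by simp [hgw]) (by simp [hgz])
      (by simp [hgu]) (by simp [hwz]) (lie_rev huw) (by simp [lie_rev huz])))))
    have := hi (-1) (by norm_num) a d b c (by rw [← h0]; abel)
    tauto
  · rw [h1, add_sub_cancel_right] at hgu
    rw [h2, add_sub_cancel_right] at hgw
    refine Or.inr (Or.inr (Or.inr (Or.inl (nonempty_lieEquiv_D40 hdim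
      (hi (-r⁻¹) (by simpa using hr)).rotate huw (by simp [huz]) ?_ (by simp [hwz]) ?_
      (by simp [lie_rev hgz])))))
    · rw [lie_smul, lie_rev hgu, smul_neg, neg_smul, neg_neg, inv_smul_smul₀ hr]
    · rw [lie_smul, lie_rev hgw, neg_smul r, neg_neg, neg_smul, inv_smul_smul₀ hr]

/-- Semidirect products with an ideal which is the Lie algebra of motions of the plane. -/
theorem isListed_of_euclidean_ideal (hdim : Module.finrank ℝ L = 4) (h : ImagAd L)
    {f x y z : L} (hind : Indep4 f x y z)
    (hbr : ∀ v v' : L, ∃ a b c : ℝ, ⁅v, v'⁆ = a • x + b • y + c • z)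
    (hxy : ⁅x, y⁆ = z) (hxz : ⁅x, z⁆ = -y) (hyz : ⁅y, z⁆ = 0) : IsListed L := by
  obtain ⟨p₂, p₃, p₄, h1⟩ := hbr f x
  obtain ⟨q₂, q₃, q₄, h2⟩ := hbr f y
  obtain ⟨r₂, r₃, r₄, h3⟩ := hbr f z
  have j1 := leibniz_lie f y z
  have j2 := leibniz_lie f x y
  have j3 := leibniz_lie f x z
  rw [h2, h3, hyz] at j1
  rw [h1, h2, hxy, h3] at j2
  rw [h1, h3, hxz, lie_neg, h2] at j3
  simp only [lie_add, add_lie, lie_smul, smul_lie, lie_self, hxy, hxz, hyz, lie_rev hxy,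
    lie_rev hyz, lie_zero] at j1 j2 j3
  -- The Jacobi identities leave `ad f` preserving the plane of `y`, `z` and acting on it as a
  -- dilation plus a rotation.
  have c1 := hind 0 0 q₂ r₂ (by rw [← sub_eq_zero] at j1; rw [← j1]; module)
  have c2 := hind 0 r₂ (r₃ + q₄) (r₄ - p₂ - q₃) (by rw [← sub_eq_zero] at j2; rw [← j2]; module)
  have c3 := hind 0 (-q₂) (-q₃ + p₂ + r₄) (-q₄ - r₃)
    (by rw [← sub_eq_zero] at j3; rw [← j3]; module)
  obtain ⟨-, -, rfl, rfl⟩ := c1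
  obtain rfl : p₂ = 0 := by linarith [c2.2.2.2, c3.2.2.1]
  obtain rfl : r₃ = -q₄ := by linarith [c2.2.2.1]
  obtain rfl : r₄ = q₃ := by linarith [c2.2.2.2]
  -- Subtracting the inner part of `ad f` leaves only the dilation by `r₄`.
  set g := f + p₄ • y - p₃ • z - q₄ • x with hg
  have hgx : ⁅g, x⁆ = 0 := by
    simp only [hg, add_lie, sub_lie, smul_lie, lie_self, h1, lie_rev hxy, lie_rev hxz]
    module
  have hgy : ⁅g, y⁆ = r₄ • y := by
    simp only [hg, add_lie, sub_lie, smul_lie, lie_self, h2, lie_rev hyz, hxy]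
    module
  have hgz : ⁅g, z⁆ = r₄ • z := by
    simp only [hg, add_lie, sub_lie, smul_lie, lie_self, h3, hyz, hxz]
    module
  have hr := h.eq_zero_of_lie_eq_smul hgz hind.ne_zero
  rw [hr, zero_smul] at hgy hgz
  -- The sign of `x` matches the orientation of the rotation in `𝔯'_{3,0}`.
  refine Or.inr (Or.inl (nonempty_lieEquiv_R30_prod hdim (x := -x) (y := y) (z := z) (w := g)
    (fun a b c d h0 => ?_) (by simp [hxy]) (by simp [hxz]) (by simp [lie_rev hgx]) hyz
    (by simp [lie_rev hgy]) (by simp [lie_rev hgz])))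
  obtain ⟨e1, e2, e3, e4⟩ := hind d (-a - d * q₄) (b + d * p₄) (c - d * p₃)
    (by rw [← h0, hg]; module)
  subst e1
  exact ⟨by simpa using e2, by simpa using e3, by simpa using e4, rfl⟩

end Classification

end LieTypeI

theorem mainTheorem7 (L : Type*) [LieRing L] [LieAlgebra ℝ L]
    (hdim : Module.finrank ℝ L = 4) (hsolv : LieAlgebra.IsSolvable L)
    (htype : LieTypeI.IsTypeI L) :
    IsLieAbelian L ∨
    Nonempty (L ≃ₗ⁅ℝ⁆ LieTypeI.R30 × ℝ) ∨
    Nonempty (L ≃ₗ⁅ℝ⁆ LieTypeI.H3 × ℝ) ∨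
    Nonempty (L ≃ₗ⁅ℝ⁆ LieTypeI.D40) ∨
    Nonempty (L ≃ₗ⁅ℝ⁆ LieTypeI.N4) := by
  obtain ⟨f, x, y, z, hind, hbr, hyz, ⟨hxy, hxz⟩ | ⟨hxy, hxz⟩ | ⟨hxy, hxz⟩⟩ :=
    LieTypeI.exists_adapted_of_finrank_four hdim hsolv htype.imagAd
  · exact LieTypeI.isListed_of_abelian_ideal hdim htype.imagAd hind hbr hxy hxz hyz
  · exact LieTypeI.isListed_of_heisenberg_ideal hdim htype.imagAd hind hbr hxy hxz hyz
  · exact LieTypeI.isListed_of_euclidean_ideal hdim htype.imagAd hind hbr hxy hxz hyz
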